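/- Work over $\mathbb{C}$. Let $X\subset\mathbb{P}^N$ be an integral, nondegenerate projective variety (a Zariski closed irreducible subset whose linear span is $\mathbb{P}^N$), with smooth locus $X_{\mathrm{reg}}$. For an integer $r\ge 0$ let $\mathcal{S}_r(X)$ be the set of all sets of $r$ distinct points of $X_{\mathrm{reg}}$. For a finite set $A\subset X_{\mathrm{reg}}$ let $\langle A\rangle$ be its linear span, let $2A\subset X$ be the closed subscheme with ideal sheaf $(\mathcal{I}_{A,X})^2$, and let $\langle 2A\rangle$ be the smallest linear subspace of $\mathbb{P}^N$ containing $2A$ (that is, the span of the projective tangent spaces $T_pX$, $p\in A$). Let $\sigma_r(X)\subset\mathbb{P}^N$ be the $r$-th secant variety, i.e. the Zariski closure of the union of the linear spans of $r$ points of $X$. Put $$\mathcal{E}_r(X)=\{A\in\mathcal{S}_r(X)\mid \langle 2A\rangle\neq\mathbb{P}^N\text{ and }\langle 2(A\cup\{p\})\rangle=\langle 2A\rangle\text{ for some }p\in X_{\mathrm{reg}}\setminus A\},$$ $$\mathbb{T}_r(X)=\{A\in\mathcal{S}_r(X)\mid \langle 2A\rangle\neq\mathbb{P}^N\text{ and }\dim\langle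 2A\rangle<r(\dim X+1)-1\}.$$ Proposition. Let $r\le\frac{N+1}{\dim X+1}-1$ and let $A\in\mathcal{S}_r(X)$ with $A\notin\mathcal{E}_r(X)\cup\mathbb{T}_r(X)$. Then every $q\in\langle A\rangle$ with $q\notin\mathrm{Sing}(\sigma_r(X))$ is an identifiable point of $X$-rank $r$. That is: there is $A'\in\mathcal{S}_r(X)$ with $q\in\langle A'\rangle$ such that $q\notin\langle B\rangle$ for every $s\le r$ and every $B\in\mathcal{S}_s(X)$ with $B\ne A'$; and $r$ is the least integer $s$ such that $q\in\langle B\rangle$ for some $B\in\mathcal{S}_s(X)$. -/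

import Mathlib

open scoped LinearAlgebra.Projectivization

noncomputable section

namespace StrongBase

/-- The complex projective space of dimension `N`. -/
abbrev PP (N : ℕ) : Type := ℙ ℂ (Fin (N + 1) → ℂ)

/-- Polynomials in the homogeneous coordinates of projective `N`-space. -/
abbrev Poly (N : ℕ) : Type := MvPolynomial (Fin (N + 1)) ℂ

variable {N : ℕ}

/-- The set of common zeros in projective space of a set of (homogeneous) polynomials. -/
def projZeros (S : Set (Poly N)) : Set (PP N) :=
  {p | ∀ f ∈ S, MvPolynomial.eval p.rep f = 0}

/-- Algebraic subsets: common zero sets of sets of homogeneous polynomials. -/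
def IsAlgebraicSet (Z : Set (PP N)) : Prop :=
  ∃ S : Set (Poly N), (∀ f ∈ S, ∃ d : ℕ, f.IsHomogeneous d) ∧ Z = projZeros S

theorem isAlgebraicSet_empty : IsAlgebraicSet (∅ : Set (PP N)) := by
  refine ⟨{1}, ?_, ?_⟩
  · rintro f rfl
    exact ⟨0, MvPolynomial.isHomogeneous_one _ _⟩
  · ext p
    simp [projZeros]

theorem isAlgebraicSet_sInter (A : Set (Set (PP N))) (hA : A ⊆ {Z | IsAlgebraicSet Z}) :
    IsAlgebraicSet (⋂₀ A) := by
  refine ⟨{f | (∃ d : ℕ, f.IsHomogeneous d) ∧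
    ∃ Z ∈ A, ∀ p ∈ Z, MvPolynomial.eval p.rep f = 0}, fun f hf => hf.1, ?_⟩
  ext p
  constructor
  · rintro hp f ⟨-, Z, hZ, hf⟩
    exact hf p (hp Z hZ)
  · intro hp Z hZ
    obtain ⟨S, hS, rfl⟩ := hA hZ
    exact fun f hf => hp f ⟨hS f hf, _, hZ, fun q hq => hq f hf⟩

theorem isAlgebraicSet_union (Z : Set (PP N)) (hZ : IsAlgebraicSet Z) (W : Set (PP N))
    (hW : IsAlgebraicSet W) : IsAlgebraicSet (Z ∪ W) := by
  obtain ⟨S, hS, rfl⟩ := hZ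
  obtain ⟨T, hT, rfl⟩ := hW
  refine ⟨{h | ∃ f ∈ S, ∃ g ∈ T, h = f * g}, ?_, ?_⟩
  · rintro _ ⟨f, hf, g, hg, rfl⟩
    obtain ⟨a, ha⟩ := hS f hf
    obtain ⟨b, hb⟩ := hT g hg
    exact ⟨a + b, ha.mul hb⟩
  · ext p
    constructor
    · rintro (hp | hp) _ ⟨f, hf, g, hg, rfl⟩
      · simp [hp f hf]
      · simp [hp g hg]
    · intro hp
      by_contra hcon
      simp only [Set.mem_union, not_or, projZeros, Set.mem_ofPred_eq, not_forall] at hcon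
      obtain ⟨⟨f, hf, hf0⟩, ⟨g, hg, hg0⟩⟩ := hcon
      have := hp (f * g) ⟨f, hf, g, hg, rfl⟩
      rw [map_mul] at this
      exact (mul_ne_zero hf0 hg0) this

/-- The Zariski topology on projective space: the closed sets are the algebraic sets. From here
on `IsClosed`, `IsIrreducible` and `closure` refer to it. -/
instance zariskiTopology (N : ℕ) : TopologicalSpace (PP N) :=
  TopologicalSpace.ofClosed {Z | IsAlgebraicSet Z} isAlgebraicSet_empty isAlgebraicSet_sInter
    isAlgebraicSet_union

/-- Integral (closed, reduced and irreducible) projective varieties, given by their points. -/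
def IsIntegralVariety (X : Set (PP N)) : Prop :=
  IsClosed X ∧ IsIrreducible X

/-- `X` is nondegenerate: its linear span is the whole projective space. -/
def IsNondegenerate (X : Set (PP N)) : Prop :=
  Projectivization.Subspace.span X = ⊤

/-- The affine cone over a set of points. -/
def affineCone (X : Set (PP N)) : Set (Fin (N + 1) → ℂ) :=
  {v | ∃ p ∈ X, v ∈ p.submodule}

/-- The homogeneous ideal `I(X)` of a set of points. -/
def homIdeal (X : Set (PP N)) : Ideal (Poly N) :=
  MvPolynomial.vanishingIdeal ℂ (affineCone X)

/-- The homogeneous coordinate ring. -/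
abbrev CoordRing (X : Set (PP N)) : Type := Poly N ⧸ homIdeal X

/-- The dimension of an integral projective variety: the transcendence degree over `ℂ` of its
homogeneous coordinate ring, minus one. -/
def varDim (X : Set (PP N)) : ℕ :=
  (Algebra.trdeg ℂ (CoordRing X)).toNat - 1

/-- The (embedded, Zariski) tangent space to `X` at `p`, as a linear subspace of `ℂ^(N+1)`:
the common kernel of the differentials at `p` of the elements of `I(X)`. Its projectivization is
the projective tangent space `T_p X`. -/
def tangentSpace (X : Set (PP N)) (p : PP N) : Submodule ℂ (Fin (N + 1) → ℂ) where
  carrier := {w | ∀ f ∈ homIdeal X,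
    ∑ i, MvPolynomial.eval p.rep (MvPolynomial.pderiv i f) * w i = 0}
  zero_mem' := by simp
  add_mem' := by
    intro a b ha hb f hf
    simp [mul_add, Finset.sum_add_distrib, ha f hf, hb f hf]
  smul_mem' := by
    intro c a ha f hf
    simp [mul_left_comm _ c, ← Finset.mul_sum, ha f hf]

/-- The smooth locus of an integral variety `X`: the points where the projective tangent space
has dimension `dim X`. -/
def smoothLocus (X : Set (PP N)) : Set (PP N) :=
  {p | p ∈ X ∧ Module.finrank ℂ (tangentSpace X p) = varDim X + 1}

/-- The singular locus of an integral variety. -/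
def singularLocus (X : Set (PP N)) : Set (PP N) :=
  X \ smoothLocus X

/-- The linear form with coefficients `c`. -/
def linForm (c : Fin (N + 1) → ℂ) : Poly N :=
  ∑ i, MvPolynomial.C (c i) * MvPolynomial.X i

/-- The linear form with coefficients `c` vanishes on the double point `2p` of `X`, the closed
subscheme of `X` with ideal sheaf `(I_{p,X})^2`: locally at `p`, the form lies in the ideal
`I(p)^2 + I(X)`. -/
def VanishesOnDoublePoint (X : Set (PP N)) (p : PP N) (c : Fin (N + 1) → ℂ) : Prop :=
  ∃ g : Poly N, MvPolynomial.eval p.rep g ≠ 0 ∧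
    g * linForm c ∈ homIdeal {p} ^ 2 ⊔ homIdeal X

/-- The linear span `⟨2A⟩` of the double points of `X` at the points of `A`, as a linear subspace
of `ℂ^(N+1)`: the common zeros of all linear forms vanishing on `2p` for every `p` in `A`. -/
def doubleSpan (X A : Set (PP N)) : Submodule ℂ (Fin (N + 1) → ℂ) where
  carrier := {w | ∀ c : Fin (N + 1) → ℂ, (∀ p ∈ A, VanishesOnDoublePoint X p c) →
    ∑ i, c i * w i = 0}
  zero_mem' := by simp
  add_mem' := by
    intro a b ha hb c hc
    simp [mul_add, Finset.sum_add_distrib, ha c hc, hb c hc]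
  smul_mem' := by
    intro t a ha c hc
    simp [mul_left_comm _ t, ← Finset.mul_sum, ha c hc]

/-- `S_r(X)`: the sets of `r` distinct smooth points of `X`. -/
def smoothSets (X : Set (PP N)) (r : ℕ) : Set (Finset (PP N)) :=
  {A | (A : Set (PP N)) ⊆ smoothLocus X ∧ A.card = r}

/-- The strong base locus `E_r(X)`. -/
def strongBaseLocus (X : Set (PP N)) (r : ℕ) : Set (Finset (PP N)) :=
  {A | A ∈ smoothSets X r ∧ doubleSpan X A ≠ ⊤ ∧
    ∃ q ∈ smoothLocus X \ (A : Set (PP N)),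
      doubleSpan X ((A : Set (PP N)) ∪ {q}) = doubleSpan X A}

/-- The Terracini locus `T_r(X)`. -/
def terraciniLocus (X : Set (PP N)) (r : ℕ) : Set (Finset (PP N)) :=
  {A | A ∈ smoothSets X r ∧ doubleSpan X A ≠ ⊤ ∧
    (Module.finrank ℂ (doubleSpan X A) : ℤ) - 1 < (r : ℤ) * ((varDim X : ℤ) + 1) - 1}

/-- The linear span `⟨A⟩` of a finite set of points. -/
abbrev pointSpan (A : Finset (PP N)) : Projectivization.Subspace ℂ (Fin (N + 1) → ℂ) :=
  Projectivization.Subspace.span (A : Set (PP N))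

/-- The `r`-th secant variety `σ_r(X)`: the Zariski closure of the union of the linear spans of
`r` points of `X`. -/
def secantVariety (X : Set (PP N)) (r : ℕ) : Set (PP N) :=
  closure {q | ∃ x : Fin r → PP N, (∀ i, x i ∈ X) ∧
    q ∈ Projectivization.Subspace.span (Set.range x)}

/-- `q` is identifiable with respect to `X`, by a set of `r` points: there is `A` in `S_r(X)` with
`q ∈ ⟨A⟩`, and `q ∉ ⟨B⟩` for every other `B` in `S_s(X)` with `s ≤ r`. -/
def IsIdentifiable (X : Set (PP N)) (r : ℕ) (q : PP N) : Prop :=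
  ∃ A ∈ smoothSets X r, q ∈ pointSpan A ∧
    ∀ s ≤ r, ∀ B ∈ smoothSets X s, B ≠ A → q ∉ pointSpan B

/-- `q` has `X`-rank `r`: `r` is the least integer such that `q ∈ ⟨A⟩` for some `A` in
`S_r(X)`. -/
def HasRank (X : Set (PP N)) (q : PP N) (r : ℕ) : Prop :=
  IsLeast {s : ℕ | ∃ A ∈ smoothSets X s, q ∈ pointSpan A} r

end StrongBase

end

noncomputable section

namespace StrongBase

open MvPolynomial Pointwise

variable {N : ℕ}

/-! ### Restriction of polynomials to lines through the origin -/

/-! The argument compares the span `⟨2A⟩` with the tangent space `T` of `σ_r(X)` at `q`. Write `n =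
dim X` and let `K` be the affine cone over `X`, so that `σ_r(X)` has the same ideal as the `r`-fold
sum `K + ... + K`.

A transcendence degree count on this sum (`varDim_secantVariety_add_one_le`) and smoothness of `q`
give `dim T ≤ r(n+1)`, which is less than `N+1` by the bound on `r`; hence `T` is not the whole
space. If `q` were a sum of `r-1` elements of `K`, then `q + tw` would stay in the `r`-fold sum for
all `w ∈ K`, so `T` would contain `K` and, by nondegeneracy, everything
(`tangentSpace_secantVariety_eq_top`). So fewer than `r` points never span `q`, and in any
expression of `q` by `r` points all coefficients are nonzero. The easy half of Terracini's lemma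
then puts `T_pX` inside `T` for every `p` in every `r`-point set `B` whose span contains `q`.

Applied to `A`, this gives `⟨2A⟩ ⊆ T`, and `A ∉ T_r(X)` forces equality by dimension. A second set
`B` would contain a point `p ∉ A` with `T_pX ⊆ T = ⟨2A⟩`, which would put `A` in `E_r(X)`. Passing
from tangent spaces to the scheme-theoretic span `⟨2A⟩` is the role of `doubleSpan_le`. -/

/-- The restriction of a polynomial to the line spanned by `v`, parametrized by `t ↦ t • v`. -/
def linePoly {σ : Type*} (v : σ → ℂ) : MvPolynomial σ ℂ →ₐ[ℂ] Polynomial ℂ :=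
  aeval fun i => Polynomial.C (v i) * Polynomial.X

theorem eval_linePoly {σ : Type*} (v : σ → ℂ) (f : MvPolynomial σ ℂ) (t : ℂ) :
    (linePoly v f).eval t = eval (t • v) f := by
  induction f using MvPolynomial.induction_on with
  | C a => simp [linePoly]
  | add p q hp hq => simp [hp, hq]
  | mul_X p i hp =>
    rw [map_mul, Polynomial.eval_mul, hp, map_mul]
    simp [linePoly, mul_comm t]

theorem linePoly_eq_zero_iff {σ : Type*} (v : σ → ℂ) (f : MvPolynomial σ ℂ) :
    linePoly v f = 0 ↔ ∀ t : ℂ, eval (t • v) f = 0 := by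
  constructor
  · intro h t
    rw [← eval_linePoly, h, Polynomial.eval_zero]
  · intro h
    refine Polynomial.funext fun t => ?_
    rw [eval_linePoly, h, Polynomial.eval_zero]

theorem _root_.MvPolynomial.IsHomogeneous.aeval_mul {σ R A : Type*} [CommSemiring R]
    [CommSemiring A] [Algebra R A] {f : MvPolynomial σ R} {d : ℕ} (hf : f.IsHomogeneous d)
    (s : A) (g : σ → A) : aeval (fun i => s * g i) f = s ^ d * aeval g f := by
  rw [aeval_def, aeval_def, eval₂_eq, eval₂_eq, Finset.mul_sum]
  refine Finset.sum_congr rfl fun e he => ?_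
  have h : ∑ i ∈ e.support, e i = d := (hf.degree_eq_sum_deg_support he).symm
  simp_rw [mul_pow, Finset.prod_mul_distrib, Finset.prod_pow_eq_pow_sum, h]
  ring

/-- The degree `d` part of `f` scales by `t ^ d` along `t • v`. Hence vanishing on a whole line
through the origin amounts to vanishing of every homogeneous part at `v`, which allows arbitrary,
not only homogeneous, polynomials below. -/
theorem coeff_linePoly {σ : Type*} (v : σ → ℂ) (f : MvPolynomial σ ℂ) (d : ℕ) :
    (linePoly v f).coeff d = eval v (homogeneousComponent d f) := by
  have key (n : ℕ) : linePoly v (homogeneousComponent n f) =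
      Polynomial.C (eval v (homogeneousComponent n f)) * Polynomial.X ^ n := by
    have h := (homogeneousComponent_isHomogeneous n f).aeval_mul (A := Polynomial ℂ)
      Polynomial.X (fun i => Polynomial.C (v i))
    rw [linePoly, mul_comm]
    simp_rw [mul_comm (Polynomial.C (v _)) Polynomial.X]
    rw [h]
    exact congrArg _ (aeval_algebraMap_apply (Polynomial ℂ) v _)
  conv_lhs => rw [← sum_homogeneousComponent f]
  rw [map_sum, Polynomial.finsetSum_coeff]
  simp_rw [key, Polynomial.coeff_C_mul_X_pow]
  rw [Finset.sum_ite_eq]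
  split_ifs with h
  · rfl
  · rw [homogeneousComponent_eq_zero _ _ (by simpa using h), map_zero]

/-! ### Homogeneous ideals of sets of points -/

theorem mem_homIdeal_iff (X : Set (PP N)) (f : Poly N) :
    f ∈ homIdeal X ↔ ∀ p ∈ X, linePoly p.rep f = 0 := by
  simp only [homIdeal, mem_vanishingIdeal_iff, affineCone, Set.mem_ofPred_eq, linePoly_eq_zero_iff,
    Projectivization.submodule_eq, Submodule.mem_span_singleton]
  constructor
  · intro h p hp t
    exact h _ ⟨p, hp, t, rfl⟩
  · rintro h _ ⟨p, hp, t, rfl⟩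
    exact h p hp t

theorem homogeneousComponent_mem_homIdeal {X : Set (PP N)} {f : Poly N} (hf : f ∈ homIdeal X)
    (d : ℕ) : homogeneousComponent d f ∈ homIdeal X := by
  rw [mem_homIdeal_iff] at hf ⊢
  intro p hp
  ext n
  rw [coeff_linePoly, homogeneousComponent_of_mem (homogeneousComponent_mem d f)]
  split_ifs with h
  · rw [← coeff_linePoly, hf p hp, Polynomial.coeff_zero, Polynomial.coeff_zero]
  · simp

theorem isClosed_setOf_linePoly_eq_zero (f : Poly N) :
    IsClosed {p : PP N | linePoly p.rep f = 0} := by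
  rw [← isOpen_compl_iff]
  change IsAlgebraicSet _
  rw [compl_compl]
  refine ⟨Set.range fun d => homogeneousComponent d f, ?_, ?_⟩
  · rintro _ ⟨d, rfl⟩
    exact ⟨d, homogeneousComponent_isHomogeneous d f⟩
  · ext p
    simp [projZeros, Polynomial.ext_iff, coeff_linePoly]

/-- Dimension and tangent spaces see only the ideal, so the closure in the definition of
`secantVariety` can be dropped. -/
theorem homIdeal_closure (X : Set (PP N)) : homIdeal (closure X) = homIdeal X := by
  ext f
  simp only [mem_homIdeal_iff]
  exact ⟨fun h p hp => h p (subset_closure hp),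
    fun h => closure_minimal h (isClosed_setOf_linePoly_eq_zero f)⟩

/-- Restriction to a line lands in the domain `ℂ[t]`, so `f * g ∈ I(X)` covers `X` by two closed
sets, one for each factor. -/
theorem isPrime_homIdeal {X : Set (PP N)} (hX : IsIrreducible X) : (homIdeal X).IsPrime := by
  refine ⟨?_, ?_⟩
  · rw [Ideal.ne_top_iff_one, mem_homIdeal_iff]
    obtain ⟨p, hp⟩ := hX.1
    intro h
    simpa using h p hp
  · intro f g hfg
    have := isPreirreducible_iff_isClosed_union_isClosed.1 hX.2 _ _
      (isClosed_setOf_linePoly_eq_zero f) (isClosed_setOf_linePoly_eq_zero g) (fun p hp => by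
        have h := (mem_homIdeal_iff X _).1 hfg p hp
        rwa [map_mul, mul_eq_zero] at h)
    rw [mem_homIdeal_iff, mem_homIdeal_iff]
    exact this

/-! ### Derivatives -/

/-- The chain rule for a derivation and a polynomial substitution. -/
theorem derivation_aeval {σ R A : Type*} [Fintype σ] [CommRing R] [CommRing A] [Algebra R A]
    (D : Derivation R A A) (g : σ → A) (f : MvPolynomial σ R) :
    D (aeval g f) = ∑ i, aeval g (pderiv i f) * D (g i) := by
  classical
  induction f using MvPolynomial.induction_on with
  | C a => simp
  | add p q hp hq => simp [hp, hq, add_mul, Finset.sum_add_distrib]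
  | mul_X p j hp =>
    simp only [map_mul, aeval_X, Derivation.leibniz, hp, smul_eq_mul, map_add, pderiv_X,
      add_mul, Finset.sum_add_distrib]
    have h : ∑ i, aeval g p * (aeval g) (Pi.single (M := fun _ => MvPolynomial σ R) i 1 j) *
        D (g i) = aeval g p * D (g j) := by
      rw [Finset.sum_eq_single j]
      · simp
      · intro i _ hi
        simp [Pi.single_eq_of_ne (Ne.symm hi)]
      · simp
    rw [h, Finset.mul_sum]
    congr 1
    exact Finset.sum_congr rfl fun i _ => by ring

/-- The first order Taylor expansion modulo the square of an ideal. -/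
theorem aeval_add_sub_mem_sq {σ R A : Type*} [Fintype σ] [CommRing R] [CommRing A] [Algebra R A]
    (J : Ideal A) (a y : σ → A) (hy : ∀ i, y i ∈ J) (f : MvPolynomial σ R) :
    aeval (fun i => a i + y i) f - aeval a f - ∑ i, aeval a (pderiv i f) * y i ∈ J ^ 2 := by
  classical
  induction f using MvPolynomial.induction_on with
  | C r => simp
  | add p q hp hq =>
    convert! add_mem hp hq using 1
    simp only [map_add, add_mul, Finset.sum_add_distrib]
    ring
  | mul_X p j hp =>
    have hs : ∑ i, aeval a (pderiv i p) * y i ∈ J :=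
      sum_mem fun i _ => J.mul_mem_left _ (hy i)
    have h1 : (∑ i, aeval a (pderiv i p) * y i) * y j ∈ J ^ 2 := by
      rw [sq]
      exact Ideal.mul_mem_mul hs (hy j)
    have h2 := (J ^ 2).mul_mem_right (a j + y j) hp
    convert! add_mem h2 h1 using 1
    simp only [map_mul, aeval_X, Derivation.leibniz, smul_eq_mul, map_add, pderiv_X,
      add_mul, Finset.sum_add_distrib]
    have h : ∑ i, aeval a p * (aeval a) (Pi.single (M := fun _ => MvPolynomial σ R) i 1 j) *
        y i = aeval a p * y j := by
      rw [Finset.sum_eq_single j]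
      · simp
      · intro i _ hi
        simp [Pi.single_eq_of_ne (Ne.symm hi)]
      · simp
    have h' : ∑ i, a j * aeval a (pderiv i p) * y i = a j * ∑ i, aeval a (pderiv i p) * y i := by
      rw [Finset.mul_sum]
      exact Finset.sum_congr rfl fun i _ => by ring
    rw [h, h']
    ring

/-! ### Vanishing ideals of products and sums of sets -/

section Sum

variable {σ : Type} {V W : Set (σ → ℂ)}

/-- The product of two subsets of affine space. -/
def affineProd (V W : Set (σ → ℂ)) : Set (σ ⊕ σ → ℂ) :=
  {z | z ∘ Sum.inl ∈ V ∧ z ∘ Sum.inr ∈ W}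

theorem nonempty_of_isPrime_vanishingIdeal (hV : (vanishingIdeal ℂ V).IsPrime) : V.Nonempty := by
  rw [Set.nonempty_iff_ne_empty]
  rintro rfl
  exact hV.ne_top vanishingIdeal_empty

theorem mem_vanishingIdeal_affineProd (f : MvPolynomial (σ ⊕ σ) ℂ) :
    f ∈ vanishingIdeal ℂ (affineProd V W) ↔ ∀ v ∈ V, ∀ w ∈ W, aeval (Sum.elim v w) f = 0 := by
  rw [mem_vanishingIdeal_iff]
  constructor
  · exact fun h v hv w hw => h _ ⟨by simpa using hv, by simpa using hw⟩
  · intro h z hz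
    have := h _ hz.1 _ hz.2
    rwa [Sum.elim_comp_inl_inr] at this

/-- Argue on slices. Primality of `I(W)` makes `f(x, ·)` or `g(x, ·)` vanish on `W` for each `x ∈
V`. If `f(v, w)` and `g(v', w')` are both nonzero, then `f(·, w) g(·, w')` still vanishes on `V`,
against primality of `I(V)`. -/
theorem isPrime_vanishingIdeal_affineProd (hV : (vanishingIdeal ℂ V).IsPrime)
    (hW : (vanishingIdeal ℂ W).IsPrime) : (vanishingIdeal ℂ (affineProd V W)).IsPrime := by
  let left (w : σ → ℂ) : MvPolynomial (σ ⊕ σ) ℂ →ₐ[ℂ] MvPolynomial σ ℂ :=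
    aeval (Sum.elim X fun i => C (w i))
  let right (v : σ → ℂ) : MvPolynomial (σ ⊕ σ) ℂ →ₐ[ℂ] MvPolynomial σ ℂ :=
    aeval (Sum.elim (fun i => C (v i)) X)
  have hleft (v w : σ → ℂ) (f) : aeval v (left w f) = aeval (Sum.elim v w) f := by
    rw [← AlgHom.comp_apply]
    congr 1
    ext (i | i) <;> simp [left]
  have hright (v w : σ → ℂ) (f) : aeval w (right v f) = aeval (Sum.elim v w) f := by
    rw [← AlgHom.comp_apply]
    congr 1
    ext (i | i) <;> simp [right]
  refine ⟨?_, ?_⟩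
  · obtain ⟨v, hv⟩ := nonempty_of_isPrime_vanishingIdeal hV
    obtain ⟨w, hw⟩ := nonempty_of_isPrime_vanishingIdeal hW
    rw [Ideal.ne_top_iff_one, mem_vanishingIdeal_affineProd]
    intro h
    simpa using h v hv w hw
  · intro f g hfg
    by_contra! hcon
    simp only [mem_vanishingIdeal_affineProd] at hcon hfg
    push Not at hcon
    obtain ⟨⟨v, hv, w, hw, hf⟩, ⟨v', hv', w', hw', hg⟩⟩ := hcon
    have key (x : σ → ℂ) (hx : x ∈ V) :
        (∀ y ∈ W, aeval (Sum.elim x y) f = 0) ∨ ∀ y ∈ W, aeval (Sum.elim x y) g = 0 := by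
      have h := hW.mem_or_mem (x := right x f) (y := right x g) (by
        intro y hy
        rw [← map_mul, hright]
        exact hfg x hx y hy)
      simpa only [mem_vanishingIdeal_iff, hright] using h
    have h := hV.mem_or_mem (x := left w f) (y := left w' g) (by
      intro x hx
      rw [map_mul, hleft, hleft]
      rcases key x hx with h | h
      · rw [h w hw, zero_mul]
      · rw [h w' hw', mul_zero])
    simp only [mem_vanishingIdeal_iff, hleft] at h
    rcases h with h | h
    · exact hf (h v hv)
    · exact hg (h v' hv')

variable (V W)

theorem vanishingIdeal_le_comap_inl : vanishingIdeal ℂ V ≤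
    (vanishingIdeal ℂ (affineProd V W)).comap (rename Sum.inl : _ →ₐ[ℂ] _) := by
  intro f hf z hz
  erw [aeval_rename]
  exact hf _ hz.1

theorem vanishingIdeal_le_comap_inr : vanishingIdeal ℂ W ≤
    (vanishingIdeal ℂ (affineProd V W)).comap (rename Sum.inr : _ →ₐ[ℂ] _) := by
  intro f hf z hz
  erw [aeval_rename]
  exact hf _ hz.2

/-- Restriction of functions along the first projection. -/
def prodLeft : MvPolynomial σ ℂ ⧸ vanishingIdeal ℂ V →ₐ[ℂ]
    MvPolynomial (σ ⊕ σ) ℂ ⧸ vanishingIdeal ℂ (affineProd V W) :=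
  Ideal.quotientMapₐ _ (rename Sum.inl) (vanishingIdeal_le_comap_inl V W)

/-- Restriction of functions along the second projection. -/
def prodRight : MvPolynomial σ ℂ ⧸ vanishingIdeal ℂ W →ₐ[ℂ]
    MvPolynomial (σ ⊕ σ) ℂ ⧸ vanishingIdeal ℂ (affineProd V W) :=
  Ideal.quotientMapₐ _ (rename Sum.inr) (vanishingIdeal_le_comap_inr V W)

theorem prodLeft_mk (f : MvPolynomial σ ℂ) :
    prodLeft V W (Ideal.Quotient.mk _ f) = Ideal.Quotient.mk _ (rename Sum.inl f) := rfl

theorem prodRight_mk (f : MvPolynomial σ ℂ) :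
    prodRight V W (Ideal.Quotient.mk _ f) = Ideal.Quotient.mk _ (rename Sum.inr f) := rfl

theorem aeval_sumElim_addition (v w : σ → ℂ) (f : MvPolynomial σ ℂ) :
    aeval (Sum.elim v w) (aeval (fun i => X (Sum.inl i) + X (Sum.inr i) :
      σ → MvPolynomial (σ ⊕ σ) ℂ) f) = aeval (v + w) f := by
  rw [← AlgHom.comp_apply]
  congr 1
  ext i
  simp

theorem vanishingIdeal_add_le_comap : vanishingIdeal ℂ (V + W) ≤
    (vanishingIdeal ℂ (affineProd V W)).comap
      (aeval (fun i => X (Sum.inl i) + X (Sum.inr i)) : _ →ₐ[ℂ] _) := by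
  intro f hf
  rw [Ideal.mem_comap, mem_vanishingIdeal_affineProd]
  intro v hv w hw
  exact (aeval_sumElim_addition v w f).trans (hf _ (Set.add_mem_add hv hw))

/-- Restriction of functions along the addition map. -/
def sumPullback : MvPolynomial σ ℂ ⧸ vanishingIdeal ℂ (V + W) →ₐ[ℂ]
    MvPolynomial (σ ⊕ σ) ℂ ⧸ vanishingIdeal ℂ (affineProd V W) :=
  Ideal.quotientMapₐ _ (aeval fun i => X (Sum.inl i) + X (Sum.inr i))
    (vanishingIdeal_add_le_comap V W)

theorem sumPullback_injective : Function.Injective (sumPullback V W) := by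
  refine Ideal.quotientMap_injective' (H := vanishingIdeal_add_le_comap V W) ?_
  intro f hf
  rw [Ideal.mem_comap] at hf
  rintro _ ⟨v, hv, w, hw, rfl⟩
  exact (aeval_sumElim_addition v w f).symm.trans
    ((mem_vanishingIdeal_affineProd _).1 hf v hv w hw)

variable {V W}

theorem prodLeft_injective (hW : W.Nonempty) : Function.Injective (prodLeft V W) := by
  obtain ⟨w, hw⟩ := hW
  refine Ideal.quotientMap_injective' (H := vanishingIdeal_le_comap_inl V W) ?_
  intro f hf v hv
  have := (mem_vanishingIdeal_affineProd _).1 hf v hv w hw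
  erw [aeval_rename] at this
  simpa using this

theorem prodRight_injective (hV : V.Nonempty) : Function.Injective (prodRight V W) := by
  obtain ⟨v, hv⟩ := hV
  refine Ideal.quotientMap_injective' (H := vanishingIdeal_le_comap_inr V W) ?_
  intro f hf w hw
  have := (mem_vanishingIdeal_affineProd _).1 hf v hv w hw
  erw [aeval_rename] at this
  simpa using this

theorem isPrime_vanishingIdeal_add (hV : (vanishingIdeal ℂ V).IsPrime)
    (hW : (vanishingIdeal ℂ W).IsPrime) : (vanishingIdeal ℂ (V + W)).IsPrime := by
  have := isPrime_vanishingIdeal_affineProd hV hW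
  have := (sumPullback_injective V W).isDomain (sumPullback V W).toRingHom
  exact (Ideal.Quotient.isDomain_iff_prime _).1 this

/-- An injective homomorphism preserves algebraicity over the subalgebra generated by a set. -/
theorem _root_.IsAlgebraic.map_adjoin {R A B : Type*} [CommRing R] [CommRing A] [CommRing B]
    [Algebra R A] [Algebra R B] {s : Set A} {t : Set B} {φ : A →ₐ[R] B}
    (hφ : Function.Injective φ) (hst : φ '' s ⊆ t) {a : A}
    (ha : IsAlgebraic (Algebra.adjoin R s) a) : IsAlgebraic (Algebra.adjoin R t) (φ a) := by
  have hle : (Algebra.adjoin R s).map φ ≤ Algebra.adjoin R t := by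
    rw [AlgHom.map_adjoin]
    exact Algebra.adjoin_mono hst
  let ψ : Algebra.adjoin R s →+* Algebra.adjoin R t :=
    (φ.comp (Algebra.adjoin R s).val).toRingHom.codRestrict (Algebra.adjoin R t)
      fun x => hle ⟨x, x.2, rfl⟩
  refine ha.ringHom_of_comp_eq ψ φ.toRingHom ?_ ?_
  · intro x y hxy
    exact Subtype.ext (hφ (congrArg Subtype.val hxy))
  · ext x
    rfl

/-- Pullback along addition embeds the coordinate ring of `V + W` in that of the product. The latter
is generated by the coordinates of the two factors, each algebraic over the union of the images of
two transcendence bases. -/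
theorem trdeg_vanishingIdeal_add_le (hV : (vanishingIdeal ℂ V).IsPrime)
    (hW : (vanishingIdeal ℂ W).IsPrime) :
    Algebra.trdeg ℂ (MvPolynomial σ ℂ ⧸ vanishingIdeal ℂ (V + W)) ≤
      Algebra.trdeg ℂ (MvPolynomial σ ℂ ⧸ vanishingIdeal ℂ V) +
      Algebra.trdeg ℂ (MvPolynomial σ ℂ ⧸ vanishingIdeal ℂ W) := by
  have := isPrime_vanishingIdeal_affineProd hV hW
  refine (trdeg_le_of_injective _ (sumPullback_injective V W)).trans ?_
  have := (faithfulSMul_iff_algebraMap_injective ℂ (MvPolynomial σ ℂ ⧸ vanishingIdeal ℂ V)).2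
    (algebraMap ℂ _).injective
  have := (faithfulSMul_iff_algebraMap_injective ℂ (MvPolynomial σ ℂ ⧸ vanishingIdeal ℂ W)).2
    (algebraMap ℂ _).injective
  obtain ⟨s, hs⟩ := exists_isTranscendenceBasis ℂ (MvPolynomial σ ℂ ⧸ vanishingIdeal ℂ V)
  obtain ⟨t, ht⟩ := exists_isTranscendenceBasis ℂ (MvPolynomial σ ℂ ⧸ vanishingIdeal ℂ W)
  rw [← hs.cardinalMk_eq_trdeg, ← ht.cardinalMk_eq_trdeg]
  have hsA := hs.isAlgebraic
  have htA := ht.isAlgebraic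
  rw [Subtype.range_coe] at hsA htA
  set u := prodLeft V W '' s ∪ prodRight V W '' t with hu
  have hVn := nonempty_of_isPrime_vanishingIdeal hV
  have hWn := nonempty_of_isPrime_vanishingIdeal hW
  let ev := Ideal.Quotient.mkₐ ℂ (vanishingIdeal ℂ (affineProd V W))
  have hgen : Algebra.adjoin ℂ (Set.range fun i => ev (X i)) = ⊤ := by
    rw [Set.range_comp' ev X, ← AlgHom.map_adjoin, adjoin_range_X, Algebra.map_top,
      AlgHom.range_eq_top]
    exact Ideal.Quotient.mkₐ_surjective _ _
  have halg : Algebra.IsAlgebraic (Algebra.adjoin ℂ u)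
      (MvPolynomial (σ ⊕ σ) ℂ ⧸ vanishingIdeal ℂ (affineProd V W)) := by
    refine ⟨fun a => ?_⟩
    have ha : IsAlgebraic (Algebra.adjoin ℂ (Set.range fun i => ev (X i))) a :=
      isAlgebraic_algebraMap (⟨a, hgen ▸ Algebra.mem_top⟩ :
        Algebra.adjoin ℂ (Set.range fun i => ev (X i)))
    refine ha.adjoin_of_forall_isAlgebraic ?_
    rintro _ ⟨⟨i | i, rfl⟩, -⟩
    · have := (hsA.isAlgebraic (Ideal.Quotient.mk _ (X i))).map_adjoin (prodLeft_injective hWn)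
        (Set.subset_union_left : _ ⊆ u)
      rw [prodLeft_mk, rename_X] at this
      exact this
    · have := (htA.isAlgebraic (Ideal.Quotient.mk _ (X i))).map_adjoin (prodRight_injective hVn)
        (Set.subset_union_right : _ ⊆ u)
      rw [prodRight_mk, rename_X] at this
      exact this
  refine (Algebra.IsAlgebraic.trdeg_le_cardinalMk ℂ u).trans ?_
  exact (Cardinal.mk_union_le _ _).trans (add_le_add Cardinal.mk_image_le Cardinal.mk_image_le)

theorem isPrime_vanishingIdeal_nsmul (hV : (vanishingIdeal ℂ V).IsPrime) (k : ℕ) :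
    (vanishingIdeal ℂ (k • V)).IsPrime ∧
      Algebra.trdeg ℂ (MvPolynomial σ ℂ ⧸ vanishingIdeal ℂ (k • V)) ≤
        k • Algebra.trdeg ℂ (MvPolynomial σ ℂ ⧸ vanishingIdeal ℂ V) := by
  induction k with
  | zero =>
    rw [zero_nsmul, zero_nsmul]
    -- The empty sum is the origin, with coordinate ring `ℂ` of transcendence degree `0`.
    have hker : vanishingIdeal ℂ (0 : Set (σ → ℂ)) =
        RingHom.ker (aeval (0 : σ → ℂ) : MvPolynomial σ ℂ →ₐ[ℂ] ℂ) := by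
      ext f
      simp [mem_vanishingIdeal_iff, RingHom.mem_ker]
    rw [hker]
    refine ⟨RingHom.ker_isPrime _, ?_⟩
    refine (trdeg_le_of_injective _ (Ideal.kerLiftAlg_injective
      (aeval (0 : σ → ℂ) : MvPolynomial σ ℂ →ₐ[ℂ] ℂ))).trans ?_
    rw [trdeg_eq_zero]
  | succ k ih =>
    rw [succ_nsmul, succ_nsmul]
    exact ⟨isPrime_vanishingIdeal_add ih.1 hV,
      (trdeg_vanishingIdeal_add_le ih.1 hV).trans (by gcongr; exact ih.2)⟩

end Sum

/-! ### Affine cones and linear spans -/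

theorem zero_mem_affineCone {X : Set (PP N)} (hX : X.Nonempty) : 0 ∈ affineCone X := by
  obtain ⟨p, hp⟩ := hX
  exact ⟨p, hp, zero_mem _⟩

theorem smul_rep_mem_affineCone {X : Set (PP N)} {p : PP N} (hp : p ∈ X) (a : ℂ) :
    a • p.rep ∈ affineCone X :=
  ⟨p, hp, by
    rw [Projectivization.submodule_eq]
    exact Submodule.smul_mem _ _ (Submodule.mem_span_singleton_self _)⟩

theorem rep_mem_span_of_mem_span {S : Set (PP N)} {q : PP N}
    (hq : q ∈ Projectivization.Subspace.span S) :
    q.rep ∈ Submodule.span ℂ (Projectivization.rep '' S) := by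
  have hle : Projectivization.Subspace.span S ≤
      (Submodule.span ℂ (Projectivization.rep '' S)).projectivization := by
    rw [Projectivization.Subspace.span_le_subspace_iff]
    intro p hp
    rw [SetLike.mem_coe, Submodule.mem_projectivization_iff_submodule_le,
      Projectivization.submodule_eq, Submodule.span_singleton_le_iff_mem]
    exact Submodule.subset_span ⟨p, hp, rfl⟩
  have h := hle hq
  rwa [Submodule.mem_projectivization_iff_submodule_le, Projectivization.submodule_eq,
    Submodule.span_singleton_le_iff_mem] at h

theorem exists_rep_eq_sum {B : Finset (PP N)} {q : PP N} (hq : q ∈ pointSpan B) :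
    ∃ a : B → ℂ, ∑ p : B, a p • (p : PP N).rep = q.rep :=
  (Submodule.mem_span_image_finset_iff_exists_fun ℂ).1 (rep_mem_span_of_mem_span hq)

theorem sum_mem_nsmul {ι M : Type*} [AddCommMonoid M] (s : Finset ι) (f : ι → M) (S : Set M)
    (hf : ∀ i ∈ s, f i ∈ S) : ∑ i ∈ s, f i ∈ s.card • S := by
  rw [← Finset.sum_const]
  exact Set.finsetSum_mem_finsetSum s _ f hf

theorem rep_mem_nsmul_affineCone {X : Set (PP N)} {B : Finset (PP N)} (hB : (B : Set (PP N)) ⊆ X)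
    {q : PP N} (hq : q ∈ pointSpan B) : q.rep ∈ B.card • affineCone X := by
  obtain ⟨a, ha⟩ := exists_rep_eq_sum hq
  rw [← ha, ← Fintype.card_coe, ← Finset.card_univ]
  exact sum_mem_nsmul _ _ _ fun p _ => smul_rep_mem_affineCone (hB p.2) _

/-- Isolates the contribution of `p`, in the form needed for Terracini's lemma; nonvanishing of `a`
is settled later. -/
theorem exists_rep_eq_add {X : Set (PP N)} {B : Finset (PP N)} (hB : (B : Set (PP N)) ⊆ X)
    {q : PP N} (hq : q ∈ pointSpan B) {p : PP N} (hp : p ∈ B) :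
    ∃ u ∈ (B.card - 1) • affineCone X, ∃ a : ℂ, q.rep = u + a • p.rep := by
  classical
  obtain ⟨a, ha⟩ := exists_rep_eq_sum hq
  refine ⟨∑ x ∈ Finset.univ.erase ⟨p, hp⟩, a x • (x : PP N).rep, ?_, a ⟨p, hp⟩, ?_⟩
  · rw [← Fintype.card_coe, ← Finset.card_univ,
      ← Finset.card_erase_of_mem (Finset.mem_univ (⟨p, hp⟩ : B))]
    exact sum_mem_nsmul _ _ _ fun p _ => smul_rep_mem_affineCone (hB p.2) _
  · rw [← ha, Finset.sum_erase_add _ _ (Finset.mem_univ (⟨p, hp⟩ : B))]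

theorem span_affineCone {X : Set (PP N)} (hX : IsNondegenerate X)
    (T : Submodule ℂ (Fin (N + 1) → ℂ)) (hT : affineCone X ⊆ T) : T = ⊤ := by
  have hle : Projectivization.Subspace.span X ≤ T.projectivization := by
    rw [Projectivization.Subspace.span_le_subspace_iff]
    intro p hp
    rw [SetLike.mem_coe, Submodule.mem_projectivization_iff_submodule_le]
    exact fun v hv => hT ⟨p, hp, hv⟩
  rw [hX, top_le_iff] at hle
  exact (map_eq_top_iff Submodule.projectivization).1 hle

/-! ### The ideal and the dimension of the secant variety -/

theorem affineCone_setOf_mem_span {X : Set (PP N)} (hX : X.Nonempty) {r : ℕ} (hr : 1 ≤ r) :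
    affineCone {q | ∃ x : Fin r → PP N, (∀ i, x i ∈ X) ∧
      q ∈ Projectivization.Subspace.span (Set.range x)} = r • affineCone X := by
  ext v
  constructor
  · rintro ⟨q, ⟨x, hx, hq⟩, hv⟩
    rw [Projectivization.submodule_eq, Submodule.mem_span_singleton] at hv
    obtain ⟨t, rfl⟩ := hv
    have hq' := rep_mem_span_of_mem_span hq
    rw [← Set.range_comp, Submodule.mem_span_range_iff_exists_fun] at hq'
    obtain ⟨c, hc⟩ := hq'
    rw [← hc, Finset.smul_sum]
    have h := sum_mem_nsmul Finset.univ (fun i => t • c i • (x i).rep) (affineCone X)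
      fun i _ => by
        rw [smul_smul]
        exact smul_rep_mem_affineCone (hx i) _
    rwa [Finset.card_univ, Fintype.card_fin] at h
  · intro hv
    have hsum : r • affineCone X = ∑ _i : Fin r, affineCone X := by simp
    rw [hsum, Set.mem_fintype_sum] at hv
    obtain ⟨g, hg, rfl⟩ := hv
    choose x hx hgx using hg
    -- The zero vector defines no projective point; it lies in the cone only because the union of
    -- spans is nonempty, which uses `1 ≤ r`.
    by_cases h0 : ∑ i, g i = 0
    · rw [h0]
      obtain ⟨p, hp⟩ := hX
      refine zero_mem_affineCone ⟨p, fun _ => p, fun _ => hp, ?_⟩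
      exact Projectivization.Subspace.subset_span _ ⟨⟨0, hr⟩, rfl⟩
    · refine ⟨Projectivization.mk ℂ _ h0, ⟨x, hx, ?_⟩, ?_⟩
      · rw [← Projectivization.Subspace.mem_submodule_iff]
        refine sum_mem fun i _ => ?_
        have hi : x i ∈ Projectivization.Subspace.span (Set.range x) :=
          Projectivization.Subspace.subset_span _ ⟨i, rfl⟩
        rw [← Projectivization.mk_rep (x i), ← Projectivization.Subspace.mem_submodule_iff] at hi
        have := hgx i
        rw [Projectivization.submodule_eq, Submodule.mem_span_singleton] at this
        obtain ⟨t, ht⟩ := this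
        rw [← ht]
        exact Submodule.smul_mem _ _ hi
      · rw [Projectivization.submodule_mk]
        exact Submodule.mem_span_singleton_self _

theorem homIdeal_secantVariety {X : Set (PP N)} (hX : X.Nonempty) {r : ℕ} (hr : 1 ≤ r) :
    homIdeal (secantVariety X r) = vanishingIdeal ℂ (r • affineCone X) := by
  rw [secantVariety, homIdeal_closure, homIdeal, affineCone_setOf_mem_span hX hr]

/-- Finiteness matters because `Cardinal.toNat` sends infinite cardinals to `0` and so is monotone
only below `ℵ₀`. -/
theorem trdeg_coordRing_lt_aleph0 (X : Set (PP N)) :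
    Algebra.trdeg ℂ (CoordRing X) < Cardinal.aleph0 := by
  refine (trdeg_le_of_surjective (Ideal.Quotient.mkₐ ℂ (homIdeal X))
    (Ideal.Quotient.mkₐ_surjective _ _)).trans_lt ?_
  rw [MvPolynomial.trdeg_of_isDomain, Cardinal.mk_fin, Cardinal.lift_natCast]
  exact Cardinal.natCast_lt_aleph0

/-- The expected upper bound for the dimension of the secant variety. -/
theorem varDim_secantVariety_add_one_le {X : Set (PP N)} (hX : IsIrreducible X) {r : ℕ}
    (hr : 1 ≤ r) : varDim (secantVariety X r) + 1 ≤ r * (varDim X + 1) := by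
  have h := (isPrime_vanishingIdeal_nsmul (isPrime_homIdeal hX) r).2
  rw [← homIdeal_secantVariety hX.1 hr] at h
  have hlt : r • Algebra.trdeg ℂ (CoordRing X) < Cardinal.aleph0 := by
    rw [nsmul_eq_mul]
    exact Cardinal.mul_lt_aleph0 (Cardinal.natCast_lt_aleph0) (trdeg_coordRing_lt_aleph0 X)
  have h' := Cardinal.toNat_le_toNat h hlt
  rw [nsmul_eq_mul, Cardinal.toNat_mul, Cardinal.toNat_natCast] at h'
  have h1 : (Algebra.trdeg ℂ (CoordRing X)).toNat ≤ varDim X + 1 := by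
    unfold varDim
    omega
  have h2 : (Algebra.trdeg ℂ (CoordRing (secantVariety X r))).toNat ≤ r * (varDim X + 1) :=
    h'.trans (Nat.mul_le_mul_left r h1)
  -- The subtraction in `varDim` is truncated, so transcendence degree `0` would still give `varDim
  -- + 1 = 1`; this covers that case.
  have h3 : 1 ≤ r * (varDim X + 1) := Nat.mul_pos hr (Nat.succ_pos _)
  unfold varDim at h2 h3 ⊢
  omega

/-! ### Tangent spaces of the secant variety -/

/-- The restriction of `f` to the line is the zero polynomial in `t`; its derivative at `t = 0` is
the stated sum. -/
theorem sum_pderiv_eq_zero_of_line {σ : Type*} [Fintype σ] {f : MvPolynomial σ ℂ} {v w : σ → ℂ}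
    (h : ∀ t : ℂ, eval (v + t • w) f = 0) : ∑ i, eval v (pderiv i f) * w i = 0 := by
  set g : σ → Polynomial ℂ := fun i => Polynomial.C (v i) + Polynomial.C (w i) * Polynomial.X
    with hg
  have heval (t : ℂ) (f : MvPolynomial σ ℂ) : (aeval g f).eval t = eval (v + t • w) f := by
    induction f using MvPolynomial.induction_on with
    | C a => simp
    | add p q hp hq => simp [hp, hq]
    | mul_X p i hp =>
      rw [map_mul, Polynomial.eval_mul, hp, map_mul]
      simp [hg, mul_comm t]
  have h0 : aeval g f = 0 := Polynomial.funext fun t => by rw [heval, h, Polynomial.eval_zero]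
  have hd := derivation_aeval Polynomial.derivative' g f
  rw [h0, map_zero] at hd
  have := congrArg (Polynomial.eval 0) hd
  rw [Polynomial.eval_zero, Polynomial.eval_finsetSum] at this
  rw [this]
  refine Finset.sum_congr rfl fun i _ => ?_
  rw [Polynomial.eval_mul, heval]
  simp [hg]

theorem tangentSpace_secantVariety_eq_top {X : Set (PP N)} (hX : X.Nonempty)
    (hnd : IsNondegenerate X) {r : ℕ} (hr : 1 ≤ r) {q : PP N}
    (hq : q.rep ∈ (r - 1) • affineCone X) : tangentSpace (secantVariety X r) q = ⊤ := by
  refine span_affineCone hnd _ ?_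
  rintro w ⟨p, hp, hw⟩ f hf
  rw [homIdeal_secantVariety hX hr] at hf
  refine sum_pderiv_eq_zero_of_line fun t => ?_
  refine hf _ ?_
  rw [← Nat.sub_add_cancel hr, succ_nsmul]
  exact Set.add_mem_add hq ⟨p, hp, Submodule.smul_mem _ _ hw⟩

/-- The easy half of Terracini's lemma. -/
theorem tangentSpace_le_tangentSpace_secantVariety {X : Set (PP N)} {r : ℕ} (hr : 1 ≤ r)
    {p q : PP N} (hp : p ∈ X) {u : Fin (N + 1) → ℂ} (hu : u ∈ (r - 1) • affineCone X) {a : ℂ}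
    (ha : a ≠ 0) (hq : q.rep = u + a • p.rep) :
    tangentSpace X p ≤ tangentSpace (secantVariety X r) q := by
  intro w hw f hf
  rw [homIdeal_secantVariety ⟨p, hp⟩ hr] at hf
  -- Substitution along `x ↦ u + a x`, which maps the cone over `X` into the `r`-fold sum and
  -- `p.rep` to `q.rep`. Thus `f` pulls back to an element of `I(X)` whose gradient at `p` is `a`
  -- times that of `f` at `q`.
  set g : Fin (N + 1) → Poly N := fun i => C (u i) + C a * MvPolynomial.X i with hg
  have heval (v : Fin (N + 1) → ℂ) (f : Poly N) : eval v (aeval g f) = eval (u + a • v) f := by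
    induction f using MvPolynomial.induction_on with
    | C a => simp
    | add p q hp hq => rw [map_add, map_add, hp, hq, map_add]
    | mul_X p i hp =>
      rw [map_mul, map_mul, hp, map_mul]
      simp [hg]
  have hmem : aeval g f ∈ homIdeal X := by
    rintro v ⟨p', hp', hv⟩
    refine (heval v f).trans (hf _ ?_)
    rw [← Nat.sub_add_cancel hr, succ_nsmul]
    exact Set.add_mem_add hu ⟨p', hp', Submodule.smul_mem _ _ hv⟩
  have hpd (j : Fin (N + 1)) :
      eval p.rep (pderiv j (aeval g f)) = a * eval q.rep (pderiv j f) := by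
    rw [derivation_aeval, map_sum, Finset.sum_eq_single j]
    · rw [map_mul, heval, ← hq]
      simp [hg, mul_comm]
    · intro i _ hi
      simp [hg, pderiv_X_of_ne hi]
    · simp
  have h := hw _ hmem
  simp only [hpd, mul_assoc] at h
  rw [← Finset.mul_sum] at h
  exact (mul_eq_zero.1 h).resolve_left ha

/-! ### Linear forms vanishing on double points -/

/-- The gradient of a polynomial at a point, as a linear map in the polynomial. -/
def gradient (v : Fin (N + 1) → ℂ) : Poly N →ₗ[ℂ] (Fin (N + 1) → ℂ) :=
  LinearMap.pi fun i => (aeval v).toLinearMap ∘ₗ (pderiv i).toLinearMap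

theorem gradient_apply (v : Fin (N + 1) → ℂ) (f : Poly N) (i : Fin (N + 1)) :
    gradient v f i = eval v (pderiv i f) := rfl

theorem linForm_add (c d : Fin (N + 1) → ℂ) : linForm (c + d) = linForm c + linForm d := by
  simp [linForm, add_mul, Finset.sum_add_distrib]

theorem linForm_zero : linForm (0 : Fin (N + 1) → ℂ) = 0 := by
  simp [linForm]

theorem linForm_sum {ι : Type*} (s : Finset ι) (c : ι → Fin (N + 1) → ℂ) :
    linForm (∑ i ∈ s, c i) = ∑ i ∈ s, linForm (c i) :=
  map_sum (AddMonoidHom.mk' linForm linForm_add) c s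

/-- A linear functional vanishing on `W` but not at `v`, given by its coefficients. -/
theorem exists_coeff_of_notMem {W : Submodule ℂ (Fin (N + 1) → ℂ)} {v : Fin (N + 1) → ℂ}
    (hv : v ∉ W) : ∃ c : Fin (N + 1) → ℂ, (∀ w ∈ W, ∑ i, c i * w i = 0) ∧
      ∑ i, c i * v i ≠ 0 := by
  obtain ⟨φ, hφv, hφW⟩ := Submodule.exists_le_ker_of_notMem hv
  have key (x : Fin (N + 1) → ℂ) :
      φ x = ∑ i, φ (fun j => if i = j then 1 else 0) * x i := by
    rw [LinearMap.pi_apply_eq_sum_univ φ x]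
    exact Finset.sum_congr rfl fun i _ => mul_comm _ _
  refine ⟨fun i => φ (fun j => if i = j then 1 else 0), fun w hw => ?_, ?_⟩
  · rw [← key]
    exact hφW hw
  · rwa [← key]

/-- Double annihilator: the tangent space is the annihilator of the space of gradients at `p` of
elements of `I(X)`, so in finite dimension a form killing it is one of these gradients. -/
theorem exists_gradient_eq {X : Set (PP N)} {p : PP N} {c : Fin (N + 1) → ℂ}
    (hc : ∀ w ∈ tangentSpace X p, ∑ i, c i * w i = 0) :
    ∃ f ∈ homIdeal X, gradient p.rep f = c := by
  by_contra hcon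
  have hc' : c ∉ ((homIdeal X).restrictScalars ℂ).map (gradient p.rep) := by
    rintro ⟨f, hf, rfl⟩
    exact hcon ⟨f, hf, rfl⟩
  obtain ⟨w, hw, hcw⟩ := exists_coeff_of_notMem hc'
  refine hcw ?_
  rw [← hc w ?_]
  · exact Finset.sum_congr rfl fun i _ => mul_comm _ _
  · intro f hf
    rw [← hw _ ⟨f, hf, rfl⟩]
    exact Finset.sum_congr rfl fun i _ => mul_comm _ _

/-- With `v = p.rep`, write `v_i x_j = v_j x_i + y_j` where `y_j ∈ I(p)`, and expand `f` at `x_i v`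
modulo `I(p)^2`. The left side `v_i^(k+1) f` lies in `I(X)`, the constant term vanishes since `f(v)
= 0`, and Euler's formula reduces the linear term to `v_i x_i^k` times the linear form. -/
theorem X_pow_mul_linForm_gradient_mem {X : Set (PP N)} {p : PP N} (hp : p ∈ X)
    {i : Fin (N + 1)} (hi : p.rep i ≠ 0) {f : Poly N} (hf : f ∈ homIdeal X) {k : ℕ}
    (hk : f.IsHomogeneous (k + 1)) :
    MvPolynomial.X i ^ k * linForm (gradient p.rep f) ∈ homIdeal {p} ^ 2 ⊔ homIdeal X := by
  set v := p.rep with hv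
  let y (j : Fin (N + 1)) : Poly N := C (v i) * MvPolynomial.X j - C (v j) * MvPolynomial.X i
  have hy (j) : y j ∈ homIdeal {p} := by
    rw [mem_homIdeal_iff]
    rintro _ rfl
    simp only [y, map_sub, map_mul, linePoly, aeval_X, ← hv, algHom_C]
    change Polynomial.C _ * _ - Polynomial.C _ * _ = _
    ring
  have hfv : eval v f = 0 := hf v ⟨p, hp, by
    rw [Projectivization.submodule_eq]
    exact Submodule.mem_span_singleton_self _⟩
  have htaylor := aeval_add_sub_mem_sq (homIdeal {p}) (fun j => MvPolynomial.X i * C (v j)) y hy f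
  have h1 : aeval (fun j => MvPolynomial.X i * C (v j) + y j) f = C (v i) ^ (k + 1) * f := by
    have : (fun j => MvPolynomial.X i * C (v j) + y j) =
        fun j => C (v i) * (MvPolynomial.X j : Poly N) := by
      funext j
      simp only [y]
      ring
    rw [this, hk.aeval_mul, aeval_X_left_apply]
  have h2 : aeval (fun j => MvPolynomial.X i * C (v j)) f = (0 : Poly N) := by
    rw [hk.aeval_mul]
    have : aeval (fun j => (C (v j) : Poly N)) f = C (eval v f) :=
      aeval_algebraMap_apply (Poly N) v f
    rw [this, hfv, C_0, mul_zero]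
  have h3 (j) : aeval (fun j => MvPolynomial.X i * C (v j)) (pderiv j f) =
      (MvPolynomial.X i ^ k * C (gradient v f j) : Poly N) := by
    rw [(hk.pderiv (i := j)).aeval_mul]
    exact congrArg _ (aeval_algebraMap_apply (Poly N) v _)
  have heuler : ∑ j, gradient v f j * v j = 0 := by
    have := congrArg (eval v) hk.sum_X_mul_pderiv
    rw [map_sum, map_nsmul, hfv, nsmul_zero] at this
    rw [← this]
    refine Finset.sum_congr rfl fun j _ => ?_
    rw [map_mul, eval_X, mul_comm, gradient_apply]
  have h4 : ∑ j, MvPolynomial.X i ^ k * C (gradient v f j) * y j =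
      C (v i) * (MvPolynomial.X i ^ k * linForm (gradient v f)) := by
    have : ∑ j, MvPolynomial.X i ^ k * C (gradient v f j) * y j =
        C (v i) * (MvPolynomial.X i ^ k * linForm (gradient v f)) -
          MvPolynomial.X i ^ (k + 1) * C (∑ j, gradient v f j * v j) := by
      rw [linForm, map_sum, Finset.mul_sum, Finset.mul_sum, Finset.mul_sum,
        ← Finset.sum_sub_distrib]
      refine Finset.sum_congr rfl fun j _ => ?_
      simp only [y, C_mul]
      ring
    rw [this, heuler, C_0, mul_zero, sub_zero]
  simp_rw [h3] at htaylor
  rw [h1, h2, h4, sub_zero] at htaylor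
  have h5 : C (v i) * (MvPolynomial.X i ^ k * linForm (gradient v f)) ∈
      homIdeal {p} ^ 2 ⊔ homIdeal X := by
    have hf' : C (v i) ^ (k + 1) * f ∈ homIdeal {p} ^ 2 ⊔ homIdeal X :=
      Ideal.mem_sup_right (Ideal.mul_mem_left _ _ hf)
    have := sub_mem hf' (Ideal.mem_sup_left htaylor)
    rwa [sub_sub_cancel] at this
  have h6 := Ideal.mul_mem_left _ (C (v i)⁻¹) h5
  rwa [← mul_assoc, ← C_mul, inv_mul_cancel₀ hi, C_1, one_mul] at h6

theorem vanishesOnDoublePoint_of_tangentSpace {X : Set (PP N)} {p : PP N} (hp : p ∈ X)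
    {c : Fin (N + 1) → ℂ} (hc : ∀ w ∈ tangentSpace X p, ∑ i, c i * w i = 0) :
    VanishesOnDoublePoint X p c := by
  obtain ⟨f, hf, rfl⟩ := exists_gradient_eq hc
  obtain ⟨i, hi⟩ := Function.ne_iff.1 p.rep_nonzero
  -- This one power of `X i` is divisible by the power `X i ^ k` required by each homogeneous
  -- component of `f`.
  refine ⟨MvPolynomial.X i ^ f.totalDegree, by simpa using fun h => absurd h hi, ?_⟩
  conv in gradient _ f => rw [← sum_homogeneousComponent f]
  rw [map_sum, linForm_sum, Finset.mul_sum]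
  refine sum_mem fun d hd => ?_
  cases d with
  | zero =>
    have : gradient p.rep (homogeneousComponent 0 f) = 0 := by
      ext j
      simp [gradient_apply]
    rw [this, linForm_zero, mul_zero]
    exact zero_mem _
  | succ k =>
    have hk : k ≤ f.totalDegree := by
      rw [Finset.mem_range] at hd
      omega
    rw [← Nat.sub_add_cancel hk, pow_add, mul_assoc]
    exact Ideal.mul_mem_left _ _ (X_pow_mul_linForm_gradient_mem hp hi
      (homogeneousComponent_mem_homIdeal hf _) (homogeneousComponent_isHomogeneous _ f))

/-- A form vanishing on `T` kills each `T_pX`, hence vanishes on each double point and so on `⟨2A⟩`.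
Only this inclusion between `⟨2A⟩` and spans of tangent spaces is needed. -/
theorem doubleSpan_le {X A : Set (PP N)} (hA : A ⊆ X) {T : Submodule ℂ (Fin (N + 1) → ℂ)}
    (hT : ∀ p ∈ A, tangentSpace X p ≤ T) : doubleSpan X A ≤ T := by
  intro w hw
  by_contra hwT
  obtain ⟨c, hcT, hcw⟩ := exists_coeff_of_notMem hwT
  exact hcw (hw c fun p hp => vanishesOnDoublePoint_of_tangentSpace (hA hp)
    fun x hx => hcT x (hT p hp hx))

theorem doubleSpan_mono {X A B : Set (PP N)} (hAB : A ⊆ B) : doubleSpan X A ≤ doubleSpan X B :=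
  fun _ hw c hc => hw c fun p hp => hc p (hAB hp)

theorem smoothLocus_subset (X : Set (PP N)) : smoothLocus X ⊆ X := fun _ hp => hp.1

theorem mem_secantVariety {X : Set (PP N)} {A : Finset (PP N)} (hA : (A : Set (PP N)) ⊆ X)
    {q : PP N} (hq : q ∈ pointSpan A) : q ∈ secantVariety X A.card := by
  refine subset_closure ⟨fun i => A.equivFin.symm i, fun i => hA (A.equivFin.symm i).2, ?_⟩
  have : Set.range (fun i => (A.equivFin.symm i : PP N)) = A := by
    rw [Set.range_comp' Subtype.val, A.equivFin.symm.range_eq_univ]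
    simp
  rwa [this]

end StrongBase

end

/-! ### Identifiability and rank at smooth points of the secant variety. -/

theorem mainTheorem8 (N : ℕ) (X : Set (StrongBase.PP N))
    (hX : StrongBase.IsIntegralVariety X) (hnd : StrongBase.IsNondegenerate X)
    (r : ℕ) (hr : (r : ℝ) ≤ ((N : ℝ) + 1) / ((StrongBase.varDim X : ℝ) + 1) - 1)
    (A : Finset (StrongBase.PP N)) (hA : A ∈ StrongBase.smoothSets X r)
    (hAE : A ∉ StrongBase.strongBaseLocus X r ∪ StrongBase.terraciniLocus X r)
    (q : StrongBase.PP N) (hqA : q ∈ StrongBase.pointSpan A)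
    (hq : q ∉ StrongBase.singularLocus (StrongBase.secantVariety X r)) :
    StrongBase.IsIdentifiable X r q ∧ StrongBase.HasRank X q r := by
  open StrongBase Pointwise in
  have hXne : X.Nonempty := hX.2.1
  have hsub {s : ℕ} {B : Finset (PP N)} (hB : B ∈ smoothSets X s) : (B : Set (PP N)) ⊆ X :=
    hB.1.trans (smoothLocus_subset X)
  -- For `r = 0` the span of `A` is empty and contains no `q`.
  have hr1 : 1 ≤ r := by
    rw [Nat.one_le_iff_ne_zero]
    rintro rfl
    have hA0 : A = ∅ := Finset.card_eq_zero.1 hA.2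
    subst hA0
    have h := rep_mem_span_of_mem_span hqA
    simp only [Finset.coe_empty, Set.image_empty, Submodule.span_empty, Submodule.mem_bot] at h
    exact q.rep_nonzero h
  have hbound : (r + 1) * (varDim X + 1) ≤ N + 1 := by
    have h : (r : ℝ) + 1 ≤ ((N : ℝ) + 1) / ((varDim X : ℝ) + 1) := by linarith
    rw [le_div_iff₀ (by positivity)] at h
    exact_mod_cast h
  set T := tangentSpace (secantVariety X r) q with hT
  have hqsec : q ∈ secantVariety X r := hA.2 ▸ mem_secantVariety (hsub hA) hqA
  have hsmooth : q ∈ smoothLocus (secantVariety X r) := by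
    by_contra h
    exact hq ⟨hqsec, h⟩
  have hTdim : Module.finrank ℂ T ≤ r * (varDim X + 1) :=
    hsmooth.2.trans_le (varDim_secantVariety_add_one_le hX.2 hr1)
  -- The bound leaves room for one more summand: `r(n+1) < (r+1)(n+1) ≤ N+1`.
  have hTtop : T ≠ ⊤ := by
    intro h
    rw [h, finrank_top, Module.finrank_fin_fun] at hTdim
    nlinarith
  have hlow : q.rep ∉ (r - 1) • affineCone X := fun h =>
    hTtop (tangentSpace_secantVariety_eq_top hXne hnd hr1 h)
  have hrank (s : ℕ) (hs : s < r) (B : Finset (PP N)) (hB : B ∈ smoothSets X s) :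
      q ∉ pointSpan B := by
    intro hqB
    have h := rep_mem_nsmul_affineCone (hsub hB) hqB
    rw [hB.2] at h
    -- Since `0` lies in the cone, a sum of `s ≤ r - 1` terms can be padded with zeros.
    exact hlow (Set.nsmul_subset_nsmul_right (zero_mem_affineCone hXne) (by omega) h)
  have htan (B : Finset (PP N)) (hB : B ∈ smoothSets X r) (hqB : q ∈ pointSpan B) (p : PP N)
      (hp : p ∈ B) : tangentSpace X p ≤ T := by
    obtain ⟨u, hu, a, ha⟩ := exists_rep_eq_add (hsub hB) hqB hp
    rw [hB.2] at hu
    refine tangentSpace_le_tangentSpace_secantVariety hr1 (hsub hB hp) hu ?_ ha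
    -- A zero coefficient at `p` would leave `q` as a sum of `r - 1` cone elements.
    rintro rfl
    rw [zero_smul, add_zero] at ha
    exact hlow (ha ▸ hu)
  have hAT : doubleSpan X A ≤ T := doubleSpan_le (hsub hA) (htan A hA hqA)
  have hAtop : doubleSpan X A ≠ ⊤ := fun h => hTtop (top_le_iff.1 (h ▸ hAT))
  have hAdim : r * (varDim X + 1) ≤ Module.finrank ℂ (doubleSpan X A) := by
    by_contra h
    refine hAE (Or.inr ⟨hA, hAtop, ?_⟩)
    push Not at h
    have : (Module.finrank ℂ (doubleSpan X A) : ℤ) < (r : ℤ) * ((varDim X : ℤ) + 1) := by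
      exact_mod_cast h
    linarith
  have hAeq : doubleSpan X A = T := Submodule.eq_of_le_of_finrank_le hAT (hTdim.trans hAdim)
  refine ⟨⟨A, hA, hqA, ?_⟩, ⟨A, hA, hqA⟩, ?_⟩
  · intro s hs B hB hBA hqB
    rcases hs.lt_or_eq with hs | rfl
    · exact hrank s hs B hB hqB
    -- `A` and `B` have the same cardinality, so `B ≠ A` forces a point of `B` outside `A`.
    obtain ⟨p, hpB, hpA⟩ : ∃ p ∈ B, p ∉ A := by
      by_contra! h
      exact hBA (Finset.eq_of_subset_of_card_le h (hA.2.trans hB.2.symm).le)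
    refine hAE (Or.inl ⟨hA, hAtop, p, ⟨hB.1 hpB, hpA⟩, le_antisymm ?_ ?_⟩)
    · rw [hAeq]
      refine doubleSpan_le (Set.union_subset (hsub hA) ?_) ?_
      · rintro _ rfl
        exact hsub hB hpB
      · rintro x (hx | rfl)
        · exact htan A hA hqA x hx
        · exact htan B hB hqB _ hpB
    · exact doubleSpan_mono Set.subset_union_left
  · rintro s ⟨B, hB, hqB⟩
    by_contra! hs
    exact hrank s hs B hB hqB
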